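/- Let $\theta$ be a permutation of $\{1,\dots,m\}\times\{1,\dots,n\}$ and let $\mathbb{F}_\theta^+$ be the unital semigroup generated by $e_1,\dots,e_m,f_1,\dots,f_n$ subject to the relations $e_if_j=f_{j'}e_{i'}$ whenever $\theta(i,j)=(i',j')$. Write $e_u$, $f_v$ for the words in the $e_i$'s and in the $f_j$'s. A representation $\sigma$ of $\mathbb{F}_\theta^+$ on a Hilbert space $\mathcal{H}$ is *atomic* if every $\sigma(w)$ is a partial isometry and there is an orthonormal basis $\{\xi_a\}$ such that each $\sigma(w)\xi_a$ equals $c\,\xi_b$ for some $b$ and some $c\in\mathbb{T}\cup\{0\}$. It is *defect free* if $\sum_i\sigma(e_i)\sigma(e_i)^*=I=\sum_j\sigma(f_j)\sigma(f_j)^*$. Its graph has as vertices the lines $\mathbb{C}\xi_a$, with a blue edge labelled $i$ (a red edge labelled $j$) from $\mathbb{C}\xi_a$ to $\mathbb{C}\xi_b$ whenever $\sigma(e_i)\mathbb{C}\xi_a=\mathbb{C}\xi_b$ (respectively $\sigma(f_j)\mathbb{C}\xi_a=\mathbb{C}\xi_b$). The *ring by ring portion* of the graph is the set of vertices lying both on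 a blue ring and on a red ring, i.e. those fixed by $\sigma(e_u)$ and by $\sigma(f_v)$ for some nonempty words $u$ and $v$. Let $G$ be a finite abelian group with two designated generators $\mathfrak{g}_1,\mathfrak{g}_2$ (together generating $G$), and let $i:G\to\{1,\dots,m\}$, $j:G\to\{1,\dots,n\}$, $\alpha,\beta:G\to\mathbb{T}$ be functions such that, for all $g\in G$, $$e_{i_{g+\mathfrak{g}_2}}f_{j_g}=f_{j_{g+\mathfrak{g}_1}}e_{i_g}\quad\text{and}\quad \alpha_{g+\mathfrak{g}_2}\beta_g=\beta_{g+\mathfrak{g}_1}\alpha_g .$$ The associated *group construction representation* $\rho$ of $\mathbb{F}_\theta^+$ on $\ell^2(G)$ is given by $\rho(e_i)\xi_g=\delta_{i,i_g}\alpha_g\xi_{g+\mathfrak{g}_1}$ and $\rho(f_j)\xi_g=\delta_{j,j_g}\beta_g\xi_{g+\mathfrak{g}_2}$. **Theorem.** Let $\sigma$ be a defect free atomic representation of $\mathbb{F}_\theta^+$ on a nonzero finite-dimensional Hilbert space $\mathcal{H}$, with connected graph with respect to the basis $\{\xi_a\}$. Then $\sigma$ is isometrically isomorphic to a dilation of a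 group construction representation for a finite group. More precisely, there are $k,l\ge1$, a subgroup $K$ of $\mathcal{C}_k\times\mathcal{C}_l$, a group construction representation $\rho$ on $\ell^2(G)$, where $G=(\mathcal{C}_k\times\mathcal{C}_l)/K$ with generators $\mathfrak{g}_1=[(1,0)]$ and $\mathfrak{g}_2=[(0,1)]$, and a linear isometry $V:\ell^2(G)\to\mathcal{H}$ such that 1. $\rho(w)=V^*\sigma(w)V$ for all $w\in\mathbb{F}_\theta^+$; 2. $V$ maps the standard basis of $\ell^2(G)$ bijectively onto the set of basis vectors $\xi_a$ in the ring by ring portion of the graph; 3. at every vertex of the ring by ring portion, the shortest nonempty closed blue path has length $k$ and the shortest nonempty closed red path has length $l$; 4. the range $\mathcal{H}_0$ of $V$ is coinvariant ($\sigma(w)^*\mathcal{H}_0\subseteq\mathcal{H}_0$ for all $w$) and cyclic ($\bigvee_w\sigma(w)\mathcal{H}_0=\mathcal{H}$). -/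

import Mathlib

namespace TwoGraph

noncomputable section

/-! ### The semigroup -/

/-- The defining commutation relations `e_i f_j = f_{j'} e_{i'}`, where `θ (i, j) = (i', j')`.
The letter `e_i` is `Sum.inl i` and the letter `f_j` is `Sum.inr j`. -/
inductive Rel {m n : ℕ} (θ : Equiv.Perm (Fin m × Fin n)) :
    FreeMonoid (Fin m ⊕ Fin n) → FreeMonoid (Fin m ⊕ Fin n) → Prop
  | comm (i : Fin m) (j : Fin n) :
      Rel θ (FreeMonoid.of (Sum.inl i) * FreeMonoid.of (Sum.inr j))
        (FreeMonoid.of (Sum.inr (θ (i, j)).2) * FreeMonoid.of (Sum.inl (θ (i, j)).1))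

/-- The semigroup `𝔽_θ⁺` with unit, given by its generators and relations. -/
abbrev Semigp {m n : ℕ} (θ : Equiv.Perm (Fin m × Fin n)) : Type := PresentedMonoid (Rel θ)

/-- The generator `e_i`. -/
def e {m n : ℕ} (θ : Equiv.Perm (Fin m × Fin n)) (i : Fin m) : Semigp θ :=
  PresentedMonoid.of (Rel θ) (Sum.inl i)

/-- The generator `f_j`. -/
def f {m n : ℕ} (θ : Equiv.Perm (Fin m × Fin n)) (j : Fin n) : Semigp θ :=
  PresentedMonoid.of (Rel θ) (Sum.inr j)

/-- The word `e_u = e_{i_1} e_{i_2} ⋯ e_{i_p}` for `u = [i_1, …, i_p]`. -/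
def eWord {m n : ℕ} (θ : Equiv.Perm (Fin m × Fin n)) (u : List (Fin m)) : Semigp θ :=
  (u.map (e θ)).prod

/-- The word `f_v = f_{j_1} f_{j_2} ⋯ f_{j_q}` for `v = [j_1, …, j_q]`. -/
def fWord {m n : ℕ} (θ : Equiv.Perm (Fin m × Fin n)) (v : List (Fin n)) : Semigp θ :=
  (v.map (f θ)).prod

/-! ### Representations -/

/-- A partial isometry of a Hilbert space: a bounded operator that is isometric on the
orthogonal complement of its kernel. -/
def IsPartialIsometry {H : Type*} [NormedAddCommGroup H] [InnerProductSpace ℂ H]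
    (T : H →L[ℂ] H) : Prop :=
  ∀ x ∈ (LinearMap.ker T.toLinearMap)ᗮ, ‖T x‖ = ‖x‖

section Representations

variable {m n : ℕ} {θ : Equiv.Perm (Fin m × Fin n)}
  {H : Type*} [NormedAddCommGroup H] [InnerProductSpace ℂ H]

/-- A representation is partially isometric if its range consists of partial isometries. -/
def IsPartiallyIsometric (σ : Semigp θ →* (H →L[ℂ] H)) : Prop :=
  ∀ w, IsPartialIsometry (σ w)

/-- `σ` is atomic with respect to the family `ξ` (used for orthonormal bases `ξ`): it is partially
isometric and each `σ w` maps each `ξ a` to a multiple `c • ξ b` of some `ξ b`, where `c` is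
unimodular or zero. -/
structure IsAtomic (σ : Semigp θ →* (H →L[ℂ] H)) {ι : Type*} (ξ : ι → H) : Prop where
  partiallyIsometric : IsPartiallyIsometric σ
  permutes : ∀ (w : Semigp θ) (a : ι), ∃ (b : ι) (c : ℂ), (‖c‖ = 1 ∨ c = 0) ∧ σ w (ξ a) = c • ξ b

/-- `∑ σ(e_i) σ(e_i)* = I = ∑ σ(f_j) σ(f_j)*`. -/
def IsDefectFree [CompleteSpace H] (σ : Semigp θ →* (H →L[ℂ] H)) : Prop :=
  (∑ i, σ (e θ i) * ContinuousLinearMap.adjoint (σ (e θ i)) = 1) ∧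
    (∑ j, σ (f θ j) * ContinuousLinearMap.adjoint (σ (f θ j)) = 1)

/-! ### The graph of an atomic representation -/

/-- `σ w` maps the line `ℂ ξ_a` onto the line `ℂ ξ_b`. -/
def Sends (σ : Semigp θ →* (H →L[ℂ] H)) {ι : Type*} (ξ : ι → H) (w : Semigp θ) (a b : ι) : Prop :=
  Submodule.map (σ w).toLinearMap (Submodule.span ℂ {ξ a}) = Submodule.span ℂ {ξ b}

/-- There is a blue edge labelled `i` from `a` to `b`. -/
def BlueEdge (σ : Semigp θ →* (H →L[ℂ] H)) {ι : Type*} (ξ : ι → H) (i : Fin m) (a b : ι) : Prop :=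
  Sends σ ξ (e θ i) a b

/-- There is a red edge labelled `j` from `a` to `b`. -/
def RedEdge (σ : Semigp θ →* (H →L[ℂ] H)) {ι : Type*} (ξ : ι → H) (j : Fin n) (a b : ι) : Prop :=
  Sends σ ξ (f θ j) a b

/-- The undirected simple graph underlying the graph of `σ`, the vertex `ℂ ξ_a` being
represented by `a`. Directions, colours, labels and loops do not matter for connectedness. -/
def graph (σ : Semigp θ →* (H →L[ℂ] H)) {ι : Type*} (ξ : ι → H) : SimpleGraph ι :=
  SimpleGraph.fromRel fun a b => (∃ i, BlueEdge σ ξ i a b) ∨ (∃ j, RedEdge σ ξ j a b)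

/-- The lengths of the nonempty closed blue paths at the vertex `a`. -/
def blueReturns (σ : Semigp θ →* (H →L[ℂ] H)) {ι : Type*} (ξ : ι → H) (a : ι) : Set ℕ :=
  {p | 0 < p ∧ ∃ u : List (Fin m), u.length = p ∧ Sends σ ξ (eWord θ u) a a}

/-- The lengths of the nonempty closed red paths at the vertex `a`. -/
def redReturns (σ : Semigp θ →* (H →L[ℂ] H)) {ι : Type*} (ξ : ι → H) (a : ι) : Set ℕ :=
  {q | 0 < q ∧ ∃ v : List (Fin n), v.length = q ∧ Sends σ ξ (fWord θ v) a a}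

/-- The ring by ring portion of the graph: the vertices that lie both on a blue ring and on a
red ring. -/
def ringByRing (σ : Semigp θ →* (H →L[ℂ] H)) {ι : Type*} (ξ : ι → H) : Set ι :=
  {a | (blueReturns σ ξ a).Nonempty ∧ (redReturns σ ξ a).Nonempty}

/-! ### Dilations -/

/-- `σ` on `H` is a dilation of `ρ` on `H₀`, where `H₀` is identified with a subspace of `H`
through the isometry `V`: `ρ w = P_{H₀} σ w |_{H₀}` for all `w`. -/
def IsDilation {H₀ : Type*} [NormedAddCommGroup H₀] [InnerProductSpace ℂ H₀] [CompleteSpace H₀]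
    [CompleteSpace H] (ρ : Semigp θ →* (H₀ →L[ℂ] H₀)) (σ : Semigp θ →* (H →L[ℂ] H))
    (V : H₀ →ₗᵢ[ℂ] H) : Prop :=
  ∀ w, ρ w = ContinuousLinearMap.adjoint V.toContinuousLinearMap ∘L σ w ∘L V.toContinuousLinearMap

/-- `M` is coinvariant: `σ(w)* M ⊆ M` for all `w`. -/
def IsCoinvariant [CompleteSpace H] (σ : Semigp θ →* (H →L[ℂ] H)) (M : Submodule ℂ H) : Prop :=
  ∀ w, ∀ x ∈ M, ContinuousLinearMap.adjoint (σ w) x ∈ M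

/-- `M` is cyclic: the subspaces `σ(w) M` together span a dense subspace. -/
def IsCyclicSubspace (σ : Semigp θ →* (H →L[ℂ] H)) (M : Submodule ℂ H) : Prop :=
  (⨆ w, Submodule.map (σ w).toLinearMap M).topologicalClosure = ⊤

end Representations

/-! ### Group construction representations -/

/-- The data of a group construction representation on an abelian group `G` with two designated
generators. The condition `rel` says that `e_{i(g+g₂)} f_{j(g)} = f_{j(g+g₁)} e_{i(g)}` is one of
the commutation relations of `𝔽_θ⁺`. -/
structure GroupData {m n : ℕ} (θ : Equiv.Perm (Fin m × Fin n)) (G : Type*) [AddCommGroup G] where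
  g₁ : G
  g₂ : G
  generate : AddSubgroup.closure {g₁, g₂} = ⊤
  i : G → Fin m
  j : G → Fin n
  α : G → Circle
  β : G → Circle
  rel : ∀ g, θ (i (g + g₂), j g) = (i g, j (g + g₁))
  scalar : ∀ g, α (g + g₂) * β g = β (g + g₁) * α g

section Shift

variable {G : Type*} [AddCommGroup G] [Fintype G]

/-- The weighted translation of `ℓ²(G)` that maps `ξ_g` to `c(g) ξ_{g+s}`. -/
def shift (s : G) (c : G → ℂ) : EuclideanSpace ℂ G →L[ℂ] EuclideanSpace ℂ G :=
  LinearMap.toContinuousLinearMap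
    { toFun := fun x => WithLp.toLp 2 fun g => c (g - s) * x (g - s)
      map_add' := fun x y => by ext g; simp [mul_add]
      map_smul' := fun a x => by ext g; simp [mul_left_comm] }

theorem shift_apply (s : G) (c : G → ℂ) (x : EuclideanSpace ℂ G) (g : G) :
    shift s c x g = c (g - s) * x (g - s) := rfl

theorem shift_single [DecidableEq G] (s : G) (c : G → ℂ) (g : G) :
    shift s c (EuclideanSpace.single g 1) = c g • EuclideanSpace.single (g + s) 1 := by
  ext h
  by_cases hh : h = g + s
  · subst hh; simp [shift_apply]
  · have : h - s ≠ g := fun h' => hh (by rw [← h']; abel)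
    simp [shift_apply, hh, this]

end Shift

section GroupRep

variable {m n : ℕ} {θ : Equiv.Perm (Fin m × Fin n)} {G : Type*} [AddCommGroup G] [Fintype G]

/-- The operators that the generators act by: `σ(e_i) ξ_g = δ_{i,i(g)} α(g) ξ_{g+g₁}` and
`σ(f_j) ξ_g = δ_{j,j(g)} β(g) ξ_{g+g₂}`. -/
def GroupData.gen (D : GroupData θ G) : Fin m ⊕ Fin n →
    (EuclideanSpace ℂ G →L[ℂ] EuclideanSpace ℂ G)
  | Sum.inl i => shift D.g₁ fun g => if i = D.i g then (D.α g : ℂ) else 0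
  | Sum.inr j => shift D.g₂ fun g => if j = D.j g then (D.β g : ℂ) else 0

theorem GroupData.gen_comm (D : GroupData θ G) (i : Fin m) (j : Fin n) :
    D.gen (Sum.inl i) * D.gen (Sum.inr j) =
      D.gen (Sum.inr (θ (i, j)).2) * D.gen (Sum.inl (θ (i, j)).1) := by
  ext x g
  obtain ⟨h, rfl⟩ : ∃ h, g = h + D.g₁ + D.g₂ := ⟨g - D.g₁ - D.g₂, by abel⟩
  have h1 : h + D.g₁ + D.g₂ - D.g₁ = h + D.g₂ := by abel
  have h2 : h + D.g₁ + D.g₂ - D.g₂ = h + D.g₁ := by abel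
  change D.gen (Sum.inl i) (D.gen (Sum.inr j) x) _ =
    D.gen (Sum.inr (θ (i, j)).2) (D.gen (Sum.inl (θ (i, j)).1) x) _
  simp only [GroupData.gen]
  rw [shift_apply, shift_apply, shift_apply, shift_apply, h1, h2]
  simp only [add_sub_cancel_right]
  have hs : (D.α (h + D.g₂) : ℂ) * D.β h = D.β (h + D.g₁) * D.α h := by
    exact_mod_cast congrArg (Subtype.val) (D.scalar h)
  have hr := D.rel h
  by_cases hij : i = D.i (h + D.g₂) ∧ j = D.j h
  · obtain ⟨rfl, rfl⟩ := hij
    rw [hr]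
    simp only [if_true, ← mul_assoc, hs]
  · have hij' : ¬((θ (i, j)).2 = D.j (h + D.g₁) ∧ (θ (i, j)).1 = D.i h) := by
      rintro ⟨ha, hb⟩
      have : θ (i, j) = θ (D.i (h + D.g₂), D.j h) := by rw [hr]; exact Prod.ext hb ha
      exact hij (Prod.ext_iff.1 (θ.injective this))
    rw [not_and_or] at hij hij'
    rcases hij with hij | hij <;> rcases hij' with hij' | hij' <;> simp [hij, hij']

/-- The group construction representation of `𝔽_θ⁺` on `ℓ²(G)`, for a finite group `G`. -/
def GroupData.rep (D : GroupData θ G) :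
    Semigp θ →* (EuclideanSpace ℂ G →L[ℂ] EuclideanSpace ℂ G) :=
  PresentedMonoid.lift D.gen (by
    rintro _ _ ⟨i, j⟩
    simpa using D.gen_comm i j)

theorem GroupData.rep_e_single [DecidableEq G] (D : GroupData θ G) (i : Fin m) (g : G) :
    D.rep (e θ i) (EuclideanSpace.single g 1) =
      (if i = D.i g then (D.α g : ℂ) else 0) • EuclideanSpace.single (g + D.g₁) 1 :=
  shift_single D.g₁ (fun g => if i = D.i g then (D.α g : ℂ) else 0) g

theorem GroupData.rep_f_single [DecidableEq G] (D : GroupData θ G) (j : Fin n) (g : G) :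
    D.rep (f θ j) (EuclideanSpace.single g 1) =
      (if j = D.j g then (D.β g : ℂ) else 0) • EuclideanSpace.single (g + D.g₂) 1 :=
  shift_single D.g₂ (fun g => if j = D.j g then (D.β g : ℂ) else 0) g

end GroupRep

end

end TwoGraph

/-! The graph is best read backwards. Expanding `‖ξ b‖ ^ 2` by defect freeness gives a sum of
squared matrix entries, each `0` or `1`, with total `1`; so every vertex has exactly one incoming
blue edge and one incoming red edge (`exists_isIncoming`). Following them backwards gives self-maps
`B` and `R` of the finite vertex set. The semigroup relations and uniqueness of incoming edges force
`B` and `R` to commute, with labels and scalars as in a group construction (`incoming_commute`). The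
ring by ring portion is the set of common periodic points. It is nonempty by finiteness and a single
orbit by connectedness, so it is a quotient of `ZMod k × ZMod l` on which `B` and `R` subtract the
generators (`exists_parametrization`). Since incoming edges of ring vertices start at ring vertices,
`V* σ(w) = ρ(w) V*`, which yields both dilation and coinvariance. Backward paths from any vertex
reach the rings, which yields cyclicity. -/

namespace TwoGraph

/-! ### Commuting self-maps of a finite set -/

section Combinatorics

open Function

theorem exists_iterate_mem_periodicPts {ι : Type*} [Finite ι] (B : ι → ι) (a : ι) :
    ∃ p, B^[p] a ∈ periodicPts B := by
  obtain ⟨x, y, hxy, h⟩ := Finite.exists_ne_map_eq_of_infinite fun p : ℕ => B^[p] a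
  wlog hlt : x < y generalizing x y
  · exact this y x hxy.symm h.symm (by omega)
  refine ⟨x, mk_mem_periodicPts (n := y - x) (by omega) ?_⟩
  change B^[y - x] (B^[x] a) = B^[x] a
  rw [← iterate_add_apply, Nat.sub_add_cancel hlt.le]
  exact h.symm

theorem iterate_mem_periodicPts {ι : Type*} {B R : ι → ι} (h : Function.Commute B R) {a : ι}
    (ha : a ∈ periodicPts B) (q : ℕ) : R^[q] a ∈ periodicPts B := by
  obtain ⟨p, hp, hpa⟩ := ha
  exact mk_mem_periodicPts hp (hpa.map (h.iterate_right q).symm)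

theorem exists_iterate_mem_periodicPts_inter {ι : Type*} [Finite ι] {B R : ι → ι}
    (h : Function.Commute B R) (a : ι) :
    ∃ p q, B^[p] (R^[q] a) ∈ periodicPts B ∩ periodicPts R := by
  obtain ⟨q, hq⟩ := exists_iterate_mem_periodicPts R a
  obtain ⟨p, hp⟩ := exists_iterate_mem_periodicPts B (R^[q] a)
  exact ⟨p, q, hp, iterate_mem_periodicPts h.symm hq p⟩

theorem exists_iterate_iterate_eq {ι : Type*} {B : ι → ι} {a : ι} (ha : a ∈ periodicPts B)
    (p : ℕ) : ∃ p', B^[p'] (B^[p] a) = a := by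
  obtain ⟨n, hn, hna⟩ := ha
  -- Since `n ≥ 1`, the subtraction does not truncate; altogether `n * p` steps are made, a multiple
  -- of the period.
  refine ⟨n * p - p, ?_⟩
  rw [← iterate_add_apply, Nat.sub_add_cancel (Nat.le_mul_of_pos_left _ hn)]
  exact hna.mul_const p

/-- Two commuting self-maps of a finite set that is connected under them act on their common
periodic points as the negatives of the two generators of a quotient of `ZMod k × ZMod l`. -/
theorem exists_parametrization {ι : Type*} [Finite ι] [Nonempty ι] {B R : ι → ι}
    (hBR : Function.Commute B R)
    (hconn : ∀ s : Set ι, s.Nonempty → (∀ a, B a ∈ s ↔ a ∈ s) → (∀ a, R a ∈ s ↔ a ∈ s) →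
      ∀ a, a ∈ s) :
    ∃ (k l : ℕ) (K : AddSubgroup (ZMod k × ZMod l)) (v : (ZMod k × ZMod l) ⧸ K → ι),
      0 < k ∧ 0 < l ∧ Injective v ∧ Set.range v = periodicPts B ∩ periodicPts R ∧
      (∀ g, B (v (g + QuotientAddGroup.mk (1, 0))) = v g) ∧
      (∀ g, R (v (g + QuotientAddGroup.mk (0, 1))) = v g) ∧
      ∀ a ∈ periodicPts B ∩ periodicPts R, minimalPeriod B a = k ∧ minimalPeriod R a = l := by
  obtain ⟨p₀, q₀, ha₀⟩ := exists_iterate_mem_periodicPts_inter hBR (Classical.arbitrary ι)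
  set a₀ := B^[p₀] (R^[q₀] (Classical.arbitrary ι))
  set k := minimalPeriod B a₀ with hk
  set l := minimalPeriod R a₀ with hl
  have hk0 : 0 < k := minimalPeriod_pos_of_mem_periodicPts ha₀.1
  have hl0 : 0 < l := minimalPeriod_pos_of_mem_periodicPts ha₀.2
  have : NeZero k := ⟨hk0.ne'⟩
  have : NeZero l := ⟨hl0.ne'⟩
  have hcomm : ∀ p q x, B^[p] (R^[q] x) = R^[q] (B^[p] x) := fun p q x =>
    (hBR.iterate_iterate p q) x
  -- The signs are negative because `B` and `R` run against the edges, while the group generators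
  -- are to run along them. Reduction modulo `k` and `l` is harmless, as these are the periods of
  -- `a₀`.
  obtain ⟨φ, hφ⟩ : ∃ φ : ZMod k × ZMod l → ι,
      ∀ p q : ℕ, φ (-(p : ZMod k), -(q : ZMod l)) = B^[p] (R^[q] a₀) := by
    refine ⟨fun z => B^[(-z.1).val] (R^[(-z.2).val] a₀), fun p q => ?_⟩
    simp only [neg_neg, ZMod.val_natCast]
    rw [hl, iterate_mod_minimalPeriod_eq, hcomm, hk, iterate_mod_minimalPeriod_eq, hcomm]
  have hrep : ∀ z : ZMod k × ZMod l, ∃ p q : ℕ, z = (-(p : ZMod k), -(q : ZMod l)) := fun z =>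
    ⟨(-z.1).val, (-z.2).val, by simp⟩
  have hadd : ∀ (p q : ℕ) (z : ZMod k × ZMod l),
      φ (z + (-(p : ZMod k), -(q : ZMod l))) = B^[p] (R^[q] (φ z)) := by
    intro p q z
    obtain ⟨p', q', rfl⟩ := hrep z
    have : ((-(p' : ZMod k), -(q' : ZMod l)) + (-(p : ZMod k), -(q : ZMod l)) : ZMod k × ZMod l) =
        (-((p + p' : ℕ) : ZMod k), -((q + q' : ℕ) : ZMod l)) := by
      ext <;> push_cast <;> simp [add_comm]
    rw [this, hφ, hφ, iterate_add_apply, iterate_add_apply, ← hcomm p' q, hcomm p' q]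
  have hφ0 : φ 0 = a₀ := by simpa [Prod.mk_zero_zero] using hφ 0 0
  have htr : ∀ w z z', φ z = φ z' → φ (z + w) = φ (z' + w) := by
    intro w z z' h
    obtain ⟨p, q, rfl⟩ := hrep w
    rw [hadd, hadd, h]
  -- The stabilizer of `a₀`; by the translation property `htr`, the fibres of `φ` are exactly its
  -- cosets.
  let K : AddSubgroup (ZMod k × ZMod l) :=
    { carrier := {z | φ z = φ 0}
      zero_mem' := rfl
      add_mem' := fun {x y} hx hy => by
        change φ (x + y) = φ 0
        rw [htr y x 0 hx, zero_add]; exact hy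
      neg_mem' := fun {x} hx => by
        change φ (-x) = φ 0
        simpa using (htr (-x) x 0 hx).symm }
  have hK : ∀ z z', -z + z' ∈ K ↔ φ z = φ z' := by
    intro z z'
    change φ (-z + z') = φ 0 ↔ _
    constructor
    · intro h
      simpa using (htr z _ _ h).symm
    · intro h
      simpa [add_comm] using (htr (-z) _ _ h).symm
  let v : (ZMod k × ZMod l) ⧸ K → ι := Quotient.lift φ fun z z' h =>
    (hK z z').1 (QuotientAddGroup.leftRel_apply.1 h)
  have hmem : ∀ z, φ z ∈ periodicPts B ∩ periodicPts R := by
    intro z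
    obtain ⟨p, q, rfl⟩ := hrep z
    rw [hφ]
    refine ⟨?_, iterate_mem_periodicPts hBR.symm (iterate_mem_periodicPts (.refl R) ha₀.2 q) p⟩
    exact iterate_mem_periodicPts (.refl B) (iterate_mem_periodicPts hBR ha₀.1 q) p
  -- The points that flow into the orbit of `a₀` form a set stable under `B` and `R` in both
  -- directions, hence everything. From a periodic point this flow can be undone by further
  -- iteration, which stays in the orbit.
  have hsurj : ∀ a ∈ periodicPts B ∩ periodicPts R, ∃ z, φ z = a := by
    intro a ha
    obtain ⟨p, q, z, h⟩ : a ∈ {a | ∃ p q z, B^[p] (R^[q] a) = φ z} := by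
      refine hconn {a | ∃ p q z, B^[p] (R^[q] a) = φ z} ⟨a₀, 0, 0, 0, hφ0.symm⟩ ?_ ?_ a
      · refine fun x => ⟨?_, ?_⟩
        · rintro ⟨p, q, z, h⟩
          exact ⟨p + 1, q, z, by rw [← h, iterate_succ_apply, ← (hBR.iterate_right q) x]⟩
        · rintro ⟨p, q, z, h⟩
          refine ⟨p, q, z + (-((1 : ℕ) : ZMod k), -((0 : ℕ) : ZMod l)), ?_⟩
          rw [hadd, ← h, ← (hBR.iterate_right q) x]
          exact (iterate_succ_apply _ _ _).symm.trans (iterate_succ_apply' _ _ _)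
      · refine fun x => ⟨?_, ?_⟩
        · rintro ⟨p, q, z, h⟩
          exact ⟨p, q + 1, z, by rw [← h, iterate_succ_apply]⟩
        · rintro ⟨p, q, z, h⟩
          refine ⟨p, q, z + (-((0 : ℕ) : ZMod k), -((1 : ℕ) : ZMod l)), ?_⟩
          rw [hadd, ← h, ← iterate_succ_apply, iterate_succ_apply']
          exact hcomm p 1 _
    obtain ⟨q', hq'⟩ := exists_iterate_iterate_eq ha.2 q
    obtain ⟨p', hp'⟩ := exists_iterate_iterate_eq ha.1 p
    refine ⟨z + (-(p' : ZMod k), -(q' : ZMod l)), ?_⟩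
    rw [hadd, ← h, hcomm p q, hcomm p' q', hcomm p' q, hp', hq']
  refine ⟨k, l, K, v, hk0, hl0, ?_, ?_, ?_, ?_, ?_⟩
  · rintro ⟨z⟩ ⟨z'⟩ h
    exact QuotientAddGroup.eq.2 ((hK z z').2 h)
  · ext a
    constructor
    · rintro ⟨⟨z⟩, rfl⟩
      exact hmem z
    · intro ha
      obtain ⟨z, hz⟩ := hsurj a ha
      exact ⟨QuotientAddGroup.mk z, hz⟩
  · rintro ⟨z⟩
    change B (φ (z + (1, 0))) = φ z
    have h := (hadd 1 0 (z + (1, 0))).symm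
    rw [add_assoc] at h
    simpa [Prod.mk_zero_zero] using h
  · rintro ⟨z⟩
    change R (φ (z + (0, 1))) = φ z
    have h := (hadd 0 1 (z + (0, 1))).symm
    rw [add_assoc] at h
    simpa [Prod.mk_zero_zero] using h
  · intro a ha
    obtain ⟨z, rfl⟩ := hsurj a ha
    obtain ⟨p, q, hz⟩ := hrep z
    obtain ⟨p', q', hz'⟩ := hrep (-z)
    have h1 : φ z = B^[p] (R^[q] a₀) := by rw [hz, hφ]
    have h2 : a₀ = B^[p'] (R^[q'] (φ z)) := by rw [← hadd, ← hz', add_neg_cancel, hφ0]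
    -- Iterates commute with `B` and `R`, so periods pass along them; `a₀` and `φ z` reach each
    -- other and thus have the same periods.
    have key : ∀ x y p q n, y = B^[p] (R^[q] x) →
        (IsPeriodicPt B n x → IsPeriodicPt B n y) ∧ (IsPeriodicPt R n x → IsPeriodicPt R n y) := by
      rintro x y p q n rfl
      exact ⟨fun h => (h.map (hBR.iterate_right q).symm).map (Function.Commute.iterate_self B p),
        fun h => (h.map (Function.Commute.iterate_self R q)).map (hBR.symm.iterate_right p).symm⟩
    exact ⟨minimalPeriod_eq_minimalPeriod_iff.2 fun n =>
      ⟨(key _ _ _ _ n h2).1, (key _ _ _ _ n h1).1⟩,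
      minimalPeriod_eq_minimalPeriod_iff.2 fun n =>
      ⟨(key _ _ _ _ n h2).2, (key _ _ _ _ n h1).2⟩⟩

end Combinatorics

/-! ### Unique incoming edges -/

section Incoming

variable {H : Type*} [NormedAddCommGroup H] [InnerProductSpace ℂ H]

/-- The edge labelled `I b` from `B b` to `b`, with scalar `A b`, is the only edge of the
family `T` of operators that ends at `b`. -/
structure IsIncoming {ι κ : Type*} (T : κ → H →L[ℂ] H) (ξ : ι → H) (B : ι → ι) (I : ι → κ)
    (A : ι → Circle) : Prop where
  apply_eq : ∀ b, T (I b) (ξ (B b)) = (A b : ℂ) • ξ b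
  exists_of_ne : ∀ i a, T i (ξ a) ≠ 0 → ∃ b, I b = i ∧ B b = a

theorem eq_of_smul_eq_smul {ι : Type*} {ξ : ι → H} (hξ : Orthonormal ℂ ξ) {c d : ℂ} (hc : c ≠ 0)
    {a b : ι} (h : c • ξ a = d • ξ b) : a = b ∧ c = d := by
  classical
  have h1 := congrArg (fun x => inner ℂ (ξ a) x) h
  simp only [inner_smul_right, orthonormal_iff_ite.1 hξ] at h1
  by_cases hab : a = b
  · exact ⟨hab, by simpa [hab] using h1⟩
  · simp [hab] at h1
    exact absurd h1 hc

namespace IsIncoming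

variable {ι κ : Type*} {T : κ → H →L[ℂ] H} {ξ : ι → H} {B : ι → ι} {I : ι → κ} {A : ι → Circle}

theorem eq_of_apply (h : IsIncoming T ξ B I A) (hξ : Orthonormal ℂ ξ) {i : κ} {a b : ι} {c : ℂ}
    (hc : c ≠ 0) (hT : T i (ξ a) = c • ξ b) : i = I b ∧ a = B b ∧ c = A b := by
  obtain ⟨b', rfl, rfl⟩ := h.exists_of_ne i a (by
    rw [hT]; exact smul_ne_zero hc (hξ.ne_zero b))
  rw [h.apply_eq] at hT
  obtain ⟨rfl, h'⟩ := eq_of_smul_eq_smul hξ (Circle.coe_ne_zero _) hT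
  exact ⟨rfl, rfl, h'.symm⟩

/-- Among all matrix entries in row `b` of the operators `T i`, the only nonzero one belongs to the
incoming edge of `b`. -/
theorem inner_apply [DecidableEq κ] [Fintype ι] {ξ : OrthonormalBasis ι ℂ H}
    (h : IsIncoming T ξ B I A) (i : κ) (b : ι) (y : H) :
    inner ℂ (ξ b) (T i y) = (if i = I b then (A b : ℂ) else 0) * inner ℂ (ξ (B b)) y := by
  classical
  have hon := orthonormal_iff_ite.1 ξ.orthonormal
  have hbasis : ∀ a, inner ℂ (ξ b) (T i (ξ a)) =
      (if i = I b then (A b : ℂ) else 0) * inner ℂ (ξ (B b)) (ξ a) := by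
    intro a
    rw [hon]
    by_cases hT : T i (ξ a) = 0
    · have : ¬ (i = I b ∧ B b = a) := by
        rintro ⟨rfl, rfl⟩
        rw [h.apply_eq] at hT
        exact smul_ne_zero (Circle.coe_ne_zero _) (ξ.orthonormal.ne_zero b) hT
      rw [hT, inner_zero_right, ite_zero_mul_ite_zero, if_neg this]
    · obtain ⟨b', rfl, rfl⟩ := h.exists_of_ne i a hT
      rw [h.apply_eq, inner_smul_right, hon, ite_zero_mul_ite_zero]
      by_cases hb : b = b'
      · simp [hb]
      · have : ¬ (I b' = I b ∧ B b = B b') := by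
          rintro ⟨h1, h2⟩
          have := h.apply_eq b'
          rw [h1, ← h2, h.apply_eq] at this
          exact hb (eq_of_smul_eq_smul ξ.orthonormal (Circle.coe_ne_zero _) this).1
        rw [if_neg hb, if_neg this, mul_zero]
  have key : (innerSL ℂ (ξ b) ∘L T i).toLinearMap =
      ((if i = I b then (A b : ℂ) else 0) • innerSL ℂ (ξ (B b))).toLinearMap :=
    ξ.toBasis.ext fun a => by
      rw [ξ.coe_toBasis]
      exact hbasis a
  exact LinearMap.congr_fun key y

theorem prod_apply_eq_zero_or (h : IsIncoming T ξ B I A) (u : List κ) (a : ι) :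
    (u.map T).prod (ξ a) = 0 ∨
      ∃ b, ∃ c : ℂ, (u.map T).prod (ξ a) = c • ξ b ∧ B^[u.length] b = a := by
  induction u with
  | nil => exact Or.inr ⟨a, 1, by simp⟩
  | cons i u ih =>
    rw [List.map_cons, List.prod_cons, mul_apply_eq_comp]
    rcases ih with h0 | ⟨b, c, hb, rfl⟩
    · exact Or.inl (by rw [h0, map_zero])
    · rw [hb, map_smul]
      by_cases hT : T i (ξ b) = 0
      · exact Or.inl (by rw [hT, smul_zero])
      · obtain ⟨b', rfl, rfl⟩ := h.exists_of_ne i b hT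
        exact Or.inr ⟨b', c * A b', by rw [h.apply_eq, smul_smul], rfl⟩

theorem iterate_eq_of_prod_apply (h : IsIncoming T ξ B I A) (hξ : Orthonormal ℂ ξ) {u : List κ}
    {a b : ι} {c : ℂ} (hc : c ≠ 0) (hu : (u.map T).prod (ξ a) = c • ξ b) :
    B^[u.length] b = a := by
  rcases h.prod_apply_eq_zero_or u a with h0 | ⟨b', c', hb, h'⟩
  · exact absurd (hu.symm.trans h0) (smul_ne_zero hc (hξ.ne_zero b))
  · rw [(eq_of_smul_eq_smul hξ hc (hu.symm.trans hb)).1, h']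

theorem exists_prod_apply (h : IsIncoming T ξ B I A) (p : ℕ) (b : ι) :
    ∃ u : List κ, u.length = p ∧
      ∃ c : ℂ, c ≠ 0 ∧ (u.map T).prod (ξ (B^[p] b)) = c • ξ b := by
  induction p generalizing b with
  | zero => exact ⟨[], rfl, 1, one_ne_zero, by simp⟩
  | succ p ih =>
    obtain ⟨u, hu, c, hc, huc⟩ := ih (B b)
    refine ⟨I b :: u, by simp [hu], c * A b, mul_ne_zero hc (Circle.coe_ne_zero _), ?_⟩
    rw [List.map_cons, List.prod_cons, mul_apply_eq_comp,
      Function.iterate_succ_apply, huc, map_smul, h.apply_eq, smul_smul]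

end IsIncoming

/-- The hypothesis on the sum, tested on `ξ b`, says that the squared entries in row `b` add up to
`1` over all labels and sources. Each is `0` or `1`, so exactly one pair contributes. -/
theorem exists_isIncoming {ι κ : Type*} [Fintype ι] [Fintype κ] [CompleteSpace H]
    (ξ : OrthonormalBasis ι ℂ H) (T : κ → H →L[ℂ] H)
    (hT : ∀ i a, ∃ (b : ι) (c : ℂ), (‖c‖ = 1 ∨ c = 0) ∧ T i (ξ a) = c • ξ b)
    (hsum : ∑ i, T i * ContinuousLinearMap.adjoint (T i) = 1) :
    ∃ (B : ι → ι) (I : ι → κ) (A : ι → Circle), IsIncoming T ξ B I A := by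
  classical
  choose s c hc hs using hT
  have hon := orthonormal_iff_ite.1 ξ.orthonormal
  have hsum1 : ∀ b, ∑ p : κ × ι, ‖inner ℂ (ξ b) (T p.1 (ξ p.2))‖ ^ 2 = 1 := by
    intro b
    have h1 : ∑ i, ‖ContinuousLinearMap.adjoint (T i) (ξ b)‖ ^ 2 = 1 := by
      have h2 := congrArg (fun S : H →L[ℂ] H => inner ℂ (ξ b) (S (ξ b))) hsum
      simp only [_root_.sum_apply, inner_sum, mul_apply_eq_comp,
        ← ContinuousLinearMap.adjoint_inner_left, inner_self_eq_norm_sq_to_K,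
        one_apply_eq_self] at h2
      simp at h2
      exact_mod_cast h2
    rw [← h1, Fintype.sum_prod_type]
    refine Finset.sum_congr rfl fun i _ => ?_
    rw [← ξ.sum_sq_norm_inner_left]
    refine Finset.sum_congr rfl fun a _ => ?_
    rw [ContinuousLinearMap.adjoint_inner_left]
  have hval : ∀ b i a, ‖inner ℂ (ξ b) (T i (ξ a))‖ ^ 2 =
      if b = s i a ∧ ‖c i a‖ = 1 then 1 else 0 := by
    intro b i a
    rw [hs, inner_smul_right, hon]
    rcases hc i a with h | h <;> by_cases hb : b = s i a <;> simp [h, hb]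
  have hcard : ∀ b,
      (Finset.univ.filter fun p : κ × ι => b = s p.1 p.2 ∧ ‖c p.1 p.2‖ = 1).card = 1 := by
    intro b
    have := hsum1 b
    simp only [hval, Finset.sum_boole] at this
    exact_mod_cast this
  choose q hq using fun b => Finset.card_eq_one.1 (hcard b)
  have hq' : ∀ b p, b = s p.1 p.2 ∧ ‖c p.1 p.2‖ = 1 ↔ p = q b := fun b p => by
    simpa using Finset.ext_iff.1 (hq b) p
  refine ⟨fun b => (q b).2, fun b => (q b).1,
    fun b => ⟨c (q b).1 (q b).2, mem_sphere_zero_iff_norm.2 ((hq' b _).2 rfl).2⟩, ?_, ?_⟩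
  · intro b
    change T (q b).1 (ξ (q b).2) = c (q b).1 (q b).2 • ξ b
    rw [hs, ← ((hq' b _).2 rfl).1]
  · intro i a h
    have h1 : ‖c i a‖ = 1 := (hc i a).resolve_right fun h0 => h (by rw [hs, h0, zero_smul])
    have h2 := (hq' (s i a) (i, a)).1 ⟨rfl, h1⟩
    exact ⟨s i a, by rw [← h2], by rw [← h2]⟩

end Incoming

/-! ### The backward maps of an atomic representation -/

section Representations

variable {m n : ℕ} {θ : Equiv.Perm (Fin m × Fin n)}

theorem e_mul_f (i : Fin m) (j : Fin n) :
    e θ i * f θ j = f θ (θ (i, j)).2 * e θ (θ (i, j)).1 :=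
  PresentedMonoid.mk_eq_mk_of_rel (Rel.comm i j)

theorem semigp_induction {p : Semigp θ → Prop} (w : Semigp θ) (one : p 1)
    (e_mul : ∀ i w, p w → p (e θ i * w)) (f_mul : ∀ j w, p w → p (f θ j * w)) : p w := by
  induction w using PresentedMonoid.inductionOn with
  | _ z =>
    induction z using FreeMonoid.inductionOn' with
    | one => exact one
    | of_mul x z ih =>
      rw [map_mul]
      rcases x with i | j
      · exact e_mul i _ ih
      · exact f_mul j _ ih

variable {H : Type*} [NormedAddCommGroup H] [InnerProductSpace ℂ H]

theorem sends_iff {ι : Type*} {σ : Semigp θ →* (H →L[ℂ] H)} {ξ : ι → H} (hξ : Orthonormal ℂ ξ)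
    {w : Semigp θ} {a b : ι} : Sends σ ξ w a b ↔ ∃ c : ℂ, c ≠ 0 ∧ σ w (ξ a) = c • ξ b := by
  rw [Sends, Submodule.map_span, Set.image_singleton, ContinuousLinearMap.coe_coe]
  constructor
  · intro h
    obtain ⟨c, hc⟩ := Submodule.mem_span_singleton.1 (h ▸ Submodule.mem_span_singleton_self _)
    refine ⟨c, ?_, hc.symm⟩
    rintro rfl
    rw [← hc, zero_smul, Submodule.span_zero_singleton] at h
    exact hξ.ne_zero b (Submodule.span_singleton_eq_bot.1 h.symm)
  · rintro ⟨c, hc, h⟩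
    rw [h, Submodule.span_singleton_smul_eq hc.isUnit]

variable {ι : Type*} {σ : Semigp θ →* (H →L[ℂ] H)} {ξ : ι → H}
  {B R : ι → ι} {I : ι → Fin m} {J : ι → Fin n} {A C : ι → Circle}

/-- The red-then-blue path of length two into `b` can be rewritten by the relation as a
blue-then-red path with the same ends. Uniqueness of incoming edges identifies its middle vertex,
labels and scalars. -/
theorem incoming_commute (hξ : Orthonormal ℂ ξ) (hatomic : IsAtomic σ ξ)
    (hB : IsIncoming (fun i => σ (e θ i)) ξ B I A) (hR : IsIncoming (fun j => σ (f θ j)) ξ R J C)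
    (b : ι) :
    B (R b) = R (B b) ∧ θ (I b, J (B b)) = (I (R b), J b) ∧ A b * C (B b) = C b * A (R b) := by
  have h1 : σ (e θ (I b) * f θ (J (B b))) (ξ (R (B b))) = ((C (B b) : ℂ) * A b) • ξ b := by
    have hb : σ (e θ (I b)) (ξ (B b)) = (A b : ℂ) • ξ b := hB.apply_eq b
    have hr : σ (f θ (J (B b))) (ξ (R (B b))) = (C (B b) : ℂ) • ξ (B b) := hR.apply_eq (B b)
    rw [map_mul, mul_apply_eq_comp, hr, map_smul, hb, smul_smul]
  rw [e_mul_f, map_mul, mul_apply_eq_comp] at h1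
  have hne : (C (B b) : ℂ) * A b ≠ 0 := mul_ne_zero (Circle.coe_ne_zero _) (Circle.coe_ne_zero _)
  -- Atomicity makes the vector after the first letter of the rewritten path a multiple of a single
  -- `ξ d`; it is nonzero because the whole path is.
  obtain ⟨d, c, -, hd⟩ := hatomic.permutes (e θ (θ (I b, J (B b))).1) (R (B b))
  have hc : c ≠ 0 := by
    rintro rfl
    rw [hd, zero_smul, map_zero] at h1
    exact smul_ne_zero hne (hξ.ne_zero b) h1.symm
  have h2 : σ (f θ (θ (I b, J (B b))).2) (ξ d) = (c⁻¹ * ((C (B b) : ℂ) * A b)) • ξ b := by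
    rw [hd, map_smul] at h1
    rw [← smul_smul, ← h1, smul_smul, inv_mul_cancel₀ hc, one_smul]
  obtain ⟨hj, rfl, hc2⟩ := hR.eq_of_apply hξ (mul_ne_zero (inv_ne_zero hc) hne) h2
  obtain ⟨hi, hRB, hc1⟩ := hB.eq_of_apply hξ hc hd
  refine ⟨hRB.symm, Prod.ext hi hj, Circle.ext ?_⟩
  rw [Circle.coe_mul, Circle.coe_mul, ← hc2, ← hc1, mul_right_comm, inv_mul_cancel₀ hc, one_mul,
    mul_comm]

theorem blueReturns_eq (hξ : Orthonormal ℂ ξ) (hB : IsIncoming (fun i => σ (e θ i)) ξ B I A)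
    (a : ι) : blueReturns σ ξ a = {p | 0 < p ∧ Function.IsPeriodicPt B p a} := by
  ext p
  refine and_congr_right fun _ => ⟨?_, fun h => ?_⟩
  · rintro ⟨u, rfl, hu⟩
    obtain ⟨c, hc, h⟩ := (sends_iff hξ).1 hu
    rw [eWord, map_list_prod, List.map_map] at h
    exact hB.iterate_eq_of_prod_apply hξ hc h
  · obtain ⟨u, hu, c, hc, h'⟩ := hB.exists_prod_apply p a
    rw [h.eq] at h'
    refine ⟨u, hu, (sends_iff hξ).2 ⟨c, hc, ?_⟩⟩
    rw [eWord, map_list_prod, List.map_map]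
    exact h'

theorem redReturns_eq (hξ : Orthonormal ℂ ξ) (hR : IsIncoming (fun j => σ (f θ j)) ξ R J C)
    (a : ι) : redReturns σ ξ a = {p | 0 < p ∧ Function.IsPeriodicPt R p a} := by
  ext p
  refine and_congr_right fun _ => ⟨?_, fun h => ?_⟩
  · rintro ⟨u, rfl, hu⟩
    obtain ⟨c, hc, h⟩ := (sends_iff hξ).1 hu
    rw [fWord, map_list_prod, List.map_map] at h
    exact hR.iterate_eq_of_prod_apply hξ hc h
  · obtain ⟨u, hu, c, hc, h'⟩ := hR.exists_prod_apply p a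
    rw [h.eq] at h'
    refine ⟨u, hu, (sends_iff hξ).2 ⟨c, hc, ?_⟩⟩
    rw [fWord, map_list_prod, List.map_map]
    exact h'

theorem ringByRing_eq (hξ : Orthonormal ℂ ξ) (hB : IsIncoming (fun i => σ (e θ i)) ξ B I A)
    (hR : IsIncoming (fun j => σ (f θ j)) ξ R J C) :
    ringByRing σ ξ = Function.periodicPts B ∩ Function.periodicPts R := by
  ext a
  simp only [ringByRing, blueReturns_eq hξ hB, redReturns_eq hξ hR]
  rfl

theorem isLeast_minimalPeriod {B : ι → ι} {a : ι} (ha : a ∈ Function.periodicPts B) :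
    IsLeast {p | 0 < p ∧ Function.IsPeriodicPt B p a} (Function.minimalPeriod B a) :=
  ⟨⟨Function.minimalPeriod_pos_of_mem_periodicPts ha, Function.isPeriodicPt_minimalPeriod B a⟩,
    fun _ hp => hp.2.minimalPeriod_le hp.1⟩

/-- Every edge has the form `B b → b` or `R b → b`, so membership in `s` is constant along
undirected walks. -/
theorem forall_mem_of_connected (hξ : Orthonormal ℂ ξ)
    (hB : IsIncoming (fun i => σ (e θ i)) ξ B I A)
    (hR : IsIncoming (fun j => σ (f θ j)) ξ R J C) (hconn : (graph σ ξ).Connected)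
    (s : Set ι) (hs : s.Nonempty) (hsB : ∀ a, B a ∈ s ↔ a ∈ s) (hsR : ∀ a, R a ∈ s ↔ a ∈ s)
    (a : ι) : a ∈ s := by
  have hedge : ∀ a b, ((∃ i, BlueEdge σ ξ i a b) ∨ ∃ j, RedEdge σ ξ j a b) →
      (a ∈ s ↔ b ∈ s) := by
    rintro a b (⟨i, h⟩ | ⟨j, h⟩)
    · obtain ⟨c, hc, h⟩ := (sends_iff hξ).1 h
      rw [(hB.eq_of_apply hξ hc h).2.1, hsB]
    · obtain ⟨c, hc, h⟩ := (sends_iff hξ).1 h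
      rw [(hR.eq_of_apply hξ hc h).2.1, hsR]
  obtain ⟨b, hb⟩ := hs
  obtain ⟨p⟩ := hconn.preconnected b a
  induction p with
  | nil => exact hb
  | cons h _ ih =>
    refine ih ?_
    rcases ((SimpleGraph.fromRel_adj _ _ _).1 h).2 with h | h
    · exact (hedge _ _ h).1 hb
    · exact (hedge _ _ h).2 hb

end Representations

/-! ### Intertwining by the adjoint of the isometry -/

section Compression

variable {m n : ℕ} {θ : Equiv.Perm (Fin m × Fin n)}
  {H : Type*} [NormedAddCommGroup H] [InnerProductSpace ℂ H] [CompleteSpace H]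
  {H₀ : Type*} [NormedAddCommGroup H₀] [InnerProductSpace ℂ H₀] [CompleteSpace H₀]
  {σ : Semigp θ →* (H →L[ℂ] H)} {ρ : Semigp θ →* (H₀ →L[ℂ] H₀)} {V : H₀ →ₗᵢ[ℂ] H}

theorem adjoint_apply_apply (V : H₀ →ₗᵢ[ℂ] H) (x : H₀) :
    ContinuousLinearMap.adjoint V.toContinuousLinearMap (V x) = x :=
  ext_inner_right ℂ fun y => by
    rw [ContinuousLinearMap.adjoint_inner_left]
    exact V.inner_map_map x y

/-- Unlike being a compression, intertwining is multiplicative in `w`, so the generators suffice. -/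
theorem adjoint_intertwines
    (he : ∀ i y, ContinuousLinearMap.adjoint V.toContinuousLinearMap (σ (e θ i) y) =
      ρ (e θ i) (ContinuousLinearMap.adjoint V.toContinuousLinearMap y))
    (hf : ∀ j y, ContinuousLinearMap.adjoint V.toContinuousLinearMap (σ (f θ j) y) =
      ρ (f θ j) (ContinuousLinearMap.adjoint V.toContinuousLinearMap y)) (w : Semigp θ) :
    ∀ y, ContinuousLinearMap.adjoint V.toContinuousLinearMap (σ w y) =
      ρ w (ContinuousLinearMap.adjoint V.toContinuousLinearMap y) := by
  induction w using semigp_induction with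
  | one => simp
  | e_mul i w ih => intro y; simp [map_mul, he, ih]
  | f_mul j w ih => intro y; simp [map_mul, hf, ih]

theorem isDilation_of_intertwines
    (h : ∀ w y, ContinuousLinearMap.adjoint V.toContinuousLinearMap (σ w y) =
      ρ w (ContinuousLinearMap.adjoint V.toContinuousLinearMap y)) : IsDilation ρ σ V := by
  intro w
  ext1 x
  change ρ w x = ContinuousLinearMap.adjoint V.toContinuousLinearMap (σ w (V x))
  rw [h, adjoint_apply_apply]

/-- Taking adjoints turns the hypothesis into `σ(w)* V = V ρ(w)*`. -/
theorem isCoinvariant_of_intertwines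
    (h : ∀ w y, ContinuousLinearMap.adjoint V.toContinuousLinearMap (σ w y) =
      ρ w (ContinuousLinearMap.adjoint V.toContinuousLinearMap y)) :
    IsCoinvariant σ (LinearMap.range V.toLinearMap) := by
  rintro w _ ⟨x, rfl⟩
  refine ⟨ContinuousLinearMap.adjoint (ρ w) x, ext_inner_right ℂ fun y => ?_⟩
  change inner ℂ (V.toContinuousLinearMap _) y = inner ℂ (_) y
  rw [ContinuousLinearMap.adjoint_inner_left, ← ContinuousLinearMap.adjoint_inner_right,
    ContinuousLinearMap.adjoint_inner_left, ← h]
  exact ContinuousLinearMap.adjoint_inner_right V.toContinuousLinearMap _ _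

end Compression

/-! ### The embedding of `ℓ²(G)` and cyclicity -/

section Isometries

variable {m n : ℕ} {θ : Equiv.Perm (Fin m × Fin n)}
  {H : Type*} [NormedAddCommGroup H] [InnerProductSpace ℂ H]

/-- The isometry that sends the standard basis of `ℓ²(G)` to an orthonormal family. -/
theorem exists_isometry_of_orthonormal {G : Type*} [Fintype G] {η : G → H}
    (hη : Orthonormal ℂ η) :
    ∃ V : EuclideanSpace ℂ G →ₗᵢ[ℂ] H, ∀ x, V x = ∑ g, x g • η g := by
  classical
  let b := EuclideanSpace.basisFun G ℂ
  have hb : (b.toBasis.constr ℂ η : EuclideanSpace ℂ G → H) ∘ b.toBasis = η := by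
    ext g
    simp
  have hon : Orthonormal ℂ b.toBasis := by simp
  refine ⟨(b.toBasis.constr ℂ η).isometryOfOrthonormal hon (hb.symm ▸ hη), fun x => ?_⟩
  change b.toBasis.constr ℂ η x = _
  rw [Module.Basis.constr_apply_fintype]
  simp [b]

/-- Going back from `b`, first along red and then along blue edges, ends at a common periodic point;
the word spelled by this path carries it forward to a nonzero multiple of `ξ b`. -/
theorem isCyclicSubspace_of_periodicPts {ι : Type*} [Fintype ι]
    {σ : Semigp θ →* (H →L[ℂ] H)} (ξ : OrthonormalBasis ι ℂ H)
    {B R : ι → ι} {I : ι → Fin m} {J : ι → Fin n} {A C : ι → Circle}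
    (hB : IsIncoming (fun i => σ (e θ i)) ξ B I A) (hR : IsIncoming (fun j => σ (f θ j)) ξ R J C)
    (hBR : Function.Commute B R) (M : Submodule ℂ H)
    (hM : ∀ a ∈ Function.periodicPts B ∩ Function.periodicPts R, ξ a ∈ M) :
    IsCyclicSubspace σ M := by
  have htop : (⨆ w, Submodule.map (σ w).toLinearMap M) = ⊤ := by
    rw [eq_top_iff, ← ξ.toBasis.span_eq, Submodule.span_le]
    rintro _ ⟨b, rfl⟩
    obtain ⟨p, q, hpq⟩ := exists_iterate_mem_periodicPts_inter hBR b
    obtain ⟨u, -, c, hc, hu⟩ := hB.exists_prod_apply p (R^[q] b)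
    obtain ⟨v, -, d, hd, hv⟩ := hR.exists_prod_apply q b
    have hw : σ (fWord θ v * eWord θ u) (ξ (B^[p] (R^[q] b))) = (c * d) • ξ b := by
      rw [map_mul, mul_apply_eq_comp, fWord, eWord, map_list_prod,
        map_list_prod, List.map_map, List.map_map]
      exact (congrArg _ hu).trans (by
        rw [map_smul, ← smul_smul]
        exact congrArg _ hv)
    have hmem := Submodule.mem_iSup_of_mem (p := fun w => Submodule.map (σ w).toLinearMap M)
      (fWord θ v * eWord θ u) (Submodule.mem_map_of_mem (hM _ hpq))
    rw [ContinuousLinearMap.coe_coe, hw] at hmem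
    simpa using (Submodule.smul_mem_iff _ (mul_ne_zero hc hd)).1 hmem
  rw [IsCyclicSubspace, htop]
  exact top_le_iff.1 (Submodule.le_topologicalClosure _)

end Isometries

theorem closure_mk_eq_top {k l : ℕ} (hk : 0 < k) (hl : 0 < l) (K : AddSubgroup (ZMod k × ZMod l)) :
    AddSubgroup.closure
      {(QuotientAddGroup.mk (1, 0) : (ZMod k × ZMod l) ⧸ K), QuotientAddGroup.mk (0, 1)} = ⊤ := by
  have : NeZero k := ⟨hk.ne'⟩
  have : NeZero l := ⟨hl.ne'⟩
  refine eq_top_iff.2 ?_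
  rintro ⟨x, y⟩ -
  have hxy : (x, y) = x.val • ((1, 0) : ZMod k × ZMod l) + y.val • (0, 1) := by ext <;> simp
  change (QuotientAddGroup.mk (x, y) : (ZMod k × ZMod l) ⧸ K) ∈ _
  rw [hxy, QuotientAddGroup.mk_add, QuotientAddGroup.mk_nsmul, QuotientAddGroup.mk_nsmul]
  exact add_mem (nsmul_mem (AddSubgroup.subset_closure (by simp)) _)
    (nsmul_mem (AddSubgroup.subset_closure (by simp)) _)

end TwoGraph

/-! ### The main theorem -/

open TwoGraph in
theorem theoremt {m n : ℕ} (θ : Equiv.Perm (Fin m × Fin n))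
    {H : Type*} [NormedAddCommGroup H] [InnerProductSpace ℂ H] [CompleteSpace H]
    [FiniteDimensional ℂ H]
    {ι : Type*} [Fintype ι] (ξ : OrthonormalBasis ι ℂ H)
    (σ : TwoGraph.Semigp θ →* (H →L[ℂ] H))
    (hatomic : TwoGraph.IsAtomic σ ξ)
    (hdefect : TwoGraph.IsDefectFree σ)
    (hconn : (TwoGraph.graph σ ξ).Connected) :
    ∃ (k l : ℕ) (K : AddSubgroup (ZMod k × ZMod l)) (_ : Fintype ((ZMod k × ZMod l) ⧸ K))
      (D : TwoGraph.GroupData θ ((ZMod k × ZMod l) ⧸ K))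
      (V : EuclideanSpace ℂ ((ZMod k × ZMod l) ⧸ K) →ₗᵢ[ℂ] H)
      (v : (ZMod k × ZMod l) ⧸ K → ι),
      0 < k ∧ 0 < l ∧
      D.g₁ = QuotientAddGroup.mk (1, 0) ∧ D.g₂ = QuotientAddGroup.mk (0, 1) ∧
      -- `σ` is, up to the isometric identification `V`, a dilation of the group construction
      TwoGraph.IsDilation D.rep σ V ∧
      -- `V` identifies the standard basis of `ℓ²(G)` with the ring by ring portion of the graph
      Function.Injective v ∧ Set.range v = TwoGraph.ringByRing σ ξ ∧
      (∀ x, V x = ∑ g, x g • ξ (v g)) ∧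
      -- all blue rings there have length `k`, and all red rings there have length `l`
      (∀ a ∈ TwoGraph.ringByRing σ ξ,
        IsLeast (TwoGraph.blueReturns σ ξ a) k ∧ IsLeast (TwoGraph.redReturns σ ξ a) l) ∧
      -- `ℓ²(G)` is a coinvariant cyclic subspace
      TwoGraph.IsCoinvariant σ (LinearMap.range V.toLinearMap) ∧
      TwoGraph.IsCyclicSubspace σ (LinearMap.range V.toLinearMap) := by
  classical
  have hξ := ξ.orthonormal
  obtain ⟨B, I, A, hB⟩ := exists_isIncoming ξ (fun i => σ (e θ i))
    (fun i a => hatomic.permutes _ a) hdefect.1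
  obtain ⟨R, J, C, hR⟩ := exists_isIncoming ξ (fun j => σ (f θ j))
    (fun j a => hatomic.permutes _ a) hdefect.2
  have hcomm := incoming_commute hξ hatomic hB hR
  have hBR : Function.Commute B R := fun b => (hcomm b).1
  have : Nonempty ι := hconn.nonempty
  obtain ⟨k, l, K, v, hk, hl, hv, hrange, hvB, hvR, hper⟩ :=
    exists_parametrization hBR (forall_mem_of_connected hξ hB hR hconn)
  have : NeZero k := ⟨hk.ne'⟩
  have : NeZero l := ⟨hl.ne'⟩
  let inst : Fintype ((ZMod k × ZMod l) ⧸ K) := Fintype.ofFinite _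
  let g₁ : (ZMod k × ZMod l) ⧸ K := QuotientAddGroup.mk (1, 0)
  let g₂ : (ZMod k × ZMod l) ⧸ K := QuotientAddGroup.mk (0, 1)
  -- This is `incoming_commute` at the far corner `g + g₁ + g₂` of a square of edges.
  have hcomm' : ∀ g, θ (I (v (g + g₂ + g₁)), J (v (g + g₂))) =
      (I (v (g + g₁)), J (v (g + g₁ + g₂))) ∧
      A (v (g + g₂ + g₁)) * C (v (g + g₂)) = C (v (g + g₁ + g₂)) * A (v (g + g₁)) := by
    intro g
    have h := (hcomm (v (g + g₂ + g₁))).2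
    rw [hvB, add_right_comm, hvR] at h
    rwa [add_right_comm]
  let D : GroupData θ ((ZMod k × ZMod l) ⧸ K) :=
    { g₁ := g₁
      g₂ := g₂
      generate := closure_mk_eq_top hk hl K
      -- The group data label the edge leaving `g`, which is the edge entering `g + g₁`; the shift
      -- by `g₂` for red edges is analogous.
      i := fun g => I (v (g + g₁))
      j := fun g => J (v (g + g₂))
      α := fun g => A (v (g + g₁))
      β := fun g => C (v (g + g₂))
      rel := fun g => (hcomm' g).1
      scalar := fun g => (hcomm' g).2 }
  obtain ⟨V, hV⟩ := exists_isometry_of_orthonormal (hξ.comp v hv)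
  have hVs : ∀ g, V (EuclideanSpace.single g 1) = ξ (v g) := fun g => by
    simp [hV, Finset.sum_ite_eq']
  have hadj : ∀ y g, ContinuousLinearMap.adjoint V.toContinuousLinearMap y g =
      inner ℂ (ξ (v g)) y := by
    intro y g
    rw [← hVs]
    have := ContinuousLinearMap.adjoint_inner_right V.toContinuousLinearMap
      (EuclideanSpace.single g 1) y
    simpa [EuclideanSpace.inner_single_left] using this
  -- At the coordinate `g`, both sides involve only the incoming edge of `v g`, whose source is `v
  -- (g - g₁)` or `v (g - g₂)`.
  have hint : ∀ w y, ContinuousLinearMap.adjoint V.toContinuousLinearMap (σ w y) =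
      D.rep w (ContinuousLinearMap.adjoint V.toContinuousLinearMap y) := by
    refine adjoint_intertwines ?_ ?_
    · intro i y
      ext g
      change _ = D.gen (Sum.inl i) _ g
      rw [hadj, GroupData.gen, shift_apply, hadj]
      have h := hB.inner_apply i (v g) y
      have hg : B (v g) = v (g - g₁) := by rw [← hvB (g - g₁), sub_add_cancel]
      simpa [D, hg] using h
    · intro j y
      ext g
      change _ = D.gen (Sum.inr j) _ g
      rw [hadj, GroupData.gen, shift_apply, hadj]
      have h := hR.inner_apply j (v g) y
      have hg : R (v g) = v (g - g₂) := by rw [← hvR (g - g₂), sub_add_cancel]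
      simpa [D, hg] using h
  have hring := ringByRing_eq hξ hB hR
  refine ⟨k, l, K, inst, D, V, v, hk, hl, rfl, rfl, isDilation_of_intertwines hint, hv,
    hrange.trans hring.symm, hV, fun a ha => ?_, isCoinvariant_of_intertwines hint,
    isCyclicSubspace_of_periodicPts ξ hB hR hBR _ ?_⟩
  · rw [hring] at ha
    rw [blueReturns_eq hξ hB, redReturns_eq hξ hR, ← (hper a ha).1, ← (hper a ha).2]
    exact ⟨isLeast_minimalPeriod ha.1, isLeast_minimalPeriod ha.2⟩
  · intro a ha
    rw [← hrange] at ha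
    obtain ⟨g, rfl⟩ := ha
    exact ⟨EuclideanSpace.single g 1, hVs g⟩
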